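/- Let $n,d\ge 0$ be integers and equip $\mathbb R^n$ with Lebesgue measure $|\cdot|$ (on Lebesgue measurable sets) and $\mathbb R^d$ with the Euclidean norm. Let $\mathcal K_{cs}(\mathbb R^d)$ be the collection of nonempty closed, convex, symmetric ($-K=K$) subsets of $\mathbb R^d$, and let $\mathcal K_{bcs}(\mathbb R^d)$ be the collection of bounded members of it. For $K\subset\mathbb R^d$ put $\|K\|=\sup\{|v|:v\in K\}\in[0,\infty]$. A closed-set valued map $F$ on $\mathbb R^n$ is measurable if $\{x:F(x)\cap U\neq\emptyset\}$ is measurable for every open $U\subset\mathbb R^d$. For $1\le p\le\infty$, $L^p_{\mathcal K}$ is the set of measurable $F:\mathbb R^n\to\mathcal K_{bcs}(\mathbb R^d)$ with $\|F\|_p=\big(\int_{\mathbb R^n}\|F(x)\|^p\,dx\big)^{1/p}<\infty$ (the essential supremum of $x\mapsto\|F(x)\|$ if $p=\infty$), and $L^{1,\infty}_{\mathcal K}$ is the set of measurable $F:\mathbb R^n\to\mathcal K_{bcs}(\mathbb R^d)$ with $\sup_{\lambda>0}\lambda\,|\{x:\|F(x)\|>\lambda\}|<\infty$. For a cube $Q$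 (nondegenerate, closed, with sides parallel to the axes) let $\int_Q F\,dy=\{\int_Q f\,dy: f\in L^1(Q,\mathbb R^d),\ f(y)\in F(y)\text{ for a.e. }y\in Q\}$ be the Aumann integral, let $A_QF(x)=\frac1{|Q|}\int_Q F\,dy$ if $x\in Q$ and $A_QF(x)=\{0\}$ if $x\notin Q$, and define $$MF(x)=\overline{\operatorname{conv}}\Big(\bigcup_Q A_QF(x)\Big),$$ the closed convex hull of the union over all cubes $Q$. **Theorem.** Let $F\in L^p_{\mathcal K}$ with $1\le p\le\infty$. Then $MF$ is a measurable map from $\mathbb R^n$ to $\mathcal K_{cs}(\mathbb R^d)$. Moreover: 1. For every $1<p\le\infty$, $M:L^p_{\mathcal K}\to L^p_{\mathcal K}$ is bounded: there is a constant $C$ depending only on $n$ and $p$ such that for every $F\in L^p_{\mathcal K}$, $MF$ agrees almost everywhere with an element of $L^p_{\mathcal K}$ (and is itself an element when $p=\infty$) and $$\|MF\|_p\le C\,\|F\|_p.$$ 2. For $p=1$, $M:L^1_{\mathcal K}\to L^{1,\infty}_{\mathcal K}$ is bounded: there is a constant $C$ depending only on $n$ such that for every $F\in L^1_{\mathcal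 K}$, $MF$ agrees almost everywhere with an element of $L^{1,\infty}_{\mathcal K}$ and, for all $\lambda>0$, $$|\{x\in\mathbb R^n:\|MF(x)\|>\lambda\}|\le\frac C\lambda\int_{\mathbb R^n}\|F(x)\|\,dx.$$ -/

import Mathlib

open MeasureTheory Set
open scoped ENNReal NNReal Pointwise

noncomputable section

namespace ConvexSetValued

/-- The class `𝒦_cs(ℝᵈ)` of nonempty, closed, convex, symmetric subsets of `ℝᵈ`
(with its Euclidean structure). -/
structure IsCS {d : ℕ} (K : Set (EuclideanSpace ℝ (Fin d))) : Prop where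
  nonempty : K.Nonempty
  isClosed : IsClosed K
  convex : Convex ℝ K
  symmetric : -K = K

/-- The class `𝒦_bcs(ℝᵈ)` of nonempty, bounded, closed, convex, symmetric subsets of `ℝᵈ`. -/
structure IsBCS {d : ℕ} (K : Set (EuclideanSpace ℝ (Fin d))) : Prop extends IsCS K where
  isBounded : Bornology.IsBounded K

/-- The norm of a set, `|K| = sup {|v| : v ∈ K}`, as an element of `[0, ∞]`. -/
def setNorm {d : ℕ} (K : Set (EuclideanSpace ℝ (Fin d))) : ℝ≥0∞ :=
  ⨆ v ∈ K, ‖v‖ₑ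

/-- Measurability of a set-valued map: `{x | F x ∩ U ≠ ∅}` is measurable for every open `U`.
The σ-algebra is the completion of the given one with respect to `μ`
(the Lebesgue σ-algebra when `μ` is Lebesgue measure), hence `NullMeasurableSet`. -/
def SetMeasurable {Ω : Type*} [MeasurableSpace Ω] {d : ℕ}
    (F : Ω → Set (EuclideanSpace ℝ (Fin d))) (μ : Measure Ω) : Prop :=
  ∀ U : Set (EuclideanSpace ℝ (Fin d)), IsOpen U → NullMeasurableSet {x | (F x ∩ U).Nonempty} μ

/-- The norm `‖F‖_p = (∫ |F(x)|^p dμ)^{1/p}` (the essential supremum of `|F|` when `p = ∞`). -/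
def normLpK {Ω : Type*} [MeasurableSpace Ω] {d : ℕ}
    (F : Ω → Set (EuclideanSpace ℝ (Fin d))) (p : ℝ≥0∞) (μ : Measure Ω) : ℝ≥0∞ :=
  eLpNorm (fun x => setNorm (F x)) p μ

/-- Membership in `L^p_𝒦(Ω, |·|)`: measurable maps into `𝒦_bcs(ℝᵈ)` with finite norm. -/
structure MemLpK {Ω : Type*} [MeasurableSpace Ω] {d : ℕ}
    (F : Ω → Set (EuclideanSpace ℝ (Fin d))) (p : ℝ≥0∞) (μ : Measure Ω) : Prop where
  isBCS : ∀ x, IsBCS (F x)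
  measurable : SetMeasurable F μ
  normLpK_lt_top : normLpK F p μ < ∞

/-- The weak norm `sup_{t > 0} t · μ {x | |F(x)| > t}`. -/
def weakL1Norm {Ω : Type*} [MeasurableSpace Ω] {d : ℕ}
    (F : Ω → Set (EuclideanSpace ℝ (Fin d))) (μ : Measure Ω) : ℝ≥0∞ :=
  ⨆ (t : ℝ) (_ : 0 < t), ENNReal.ofReal t * μ {x | ENNReal.ofReal t < setNorm (F x)}

/-- Membership in `L^{1,∞}_𝒦(Ω, |·|)`: measurable maps into `𝒦_bcs(ℝᵈ)` with finite weak norm. -/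
structure MemWeakL1K {Ω : Type*} [MeasurableSpace Ω] {d : ℕ}
    (F : Ω → Set (EuclideanSpace ℝ (Fin d))) (μ : Measure Ω) : Prop where
  isBCS : ∀ x, IsBCS (F x)
  measurable : SetMeasurable F μ
  weakL1Norm_lt_top : weakL1Norm F μ < ∞

/-- The Aumann integral of `F` with respect to `μ`: the set of integrals of all integrable
selections of `F`. -/
def aumannIntegral {Ω : Type*} [MeasurableSpace Ω] {d : ℕ}
    (F : Ω → Set (EuclideanSpace ℝ (Fin d))) (μ : Measure Ω) : Set (EuclideanSpace ℝ (Fin d)) :=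
  {v | ∃ f : Ω → EuclideanSpace ℝ (Fin d),
    Integrable f μ ∧ (∀ᵐ x ∂μ, f x ∈ F x) ∧ ∫ x, f x ∂μ = v}

/-- Nondegenerate closed cubes in `ℝⁿ` with sides parallel to the axes. -/
def IsCube {n : ℕ} (Q : Set (Fin n → ℝ)) : Prop :=
  ∃ (a : Fin n → ℝ) (l : ℝ), 0 < l ∧ Q = Icc a (fun i => a i + l)

open Classical in
/-- The averaging operator `A_Q F(x) = (1 / |Q|) ∫_Q F(y) dy · χ_Q(x)`. -/
def averageOp {n d : ℕ} (Q : Set (Fin n → ℝ))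
    (F : (Fin n → ℝ) → Set (EuclideanSpace ℝ (Fin d))) (x : Fin n → ℝ) :
    Set (EuclideanSpace ℝ (Fin d)) :=
  if x ∈ Q then ((volume Q).toReal)⁻¹ • aumannIntegral F (volume.restrict Q) else {0}

/-- The convex-set valued Hardy–Littlewood maximal operator: the closed convex hull of
the union over all cubes `Q` of `A_Q F(x)`. -/
def maximalOp {n d : ℕ} (F : (Fin n → ℝ) → Set (EuclideanSpace ℝ (Fin d)))
    (x : Fin n → ℝ) : Set (EuclideanSpace ℝ (Fin d)) :=
  closure (convexHull ℝ (⋃ (Q : Set (Fin n → ℝ)) (_ : IsCube Q), averageOp Q F x))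

end ConvexSetValued

end

noncomputable section

namespace ConvexSetValued

/-! Everything reduces to the scalar maximal function. A vector in `A_Q F(x)` is the average of a
selection, so its norm is at most the average of `‖F‖` over `Q`. A closed ball about `0` is closed
and convex, so taking the closed convex hull does not enlarge this bound, and `setNorm_maximalOp_le`
gives `‖MF(x)‖ ≤ ballMaximal ‖F‖ x` at every `x`. Cubes are exactly the closed sup-norm balls of
positive radius; Vitali covering then yields weak type (1,1), the `L^∞` bound is immediate, and a
Marcinkiewicz argument gives `1 < p < ∞`. No constant sees `d`.

Measurability comes from lower semicontinuity: `{x | MF(x) ∩ U ≠ ∅}` is open for open `U`. Dilating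
a cube slightly makes it a neighbourhood of each of its points, while its averages shrink only by a
factor close to `1`, because `0 ∈ F(y)` lets selections be extended by zero.

Finally, the estimates make `‖MF‖` finite almost everywhere, so changing `MF` on a null set gives
bounded values. -/

/-! ### Layer-cake formula and Marcinkiewicz interpolation. -/

theorem lintegral_rpow_layer_real {q b : ℝ} (hq : 0 < q) (hb : 0 ≤ b) :
    ∫⁻ t in Ioo 0 b, ENNReal.ofReal (q * t ^ (q - 1)) = ENNReal.ofReal (b ^ q) := by
  have hint : IntegrableOn (fun t : ℝ => q * t ^ (q - 1)) (Ioo 0 b) := by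
    refine IntegrableOn.mono_set ?_ Ioo_subset_Ioc_self
    rw [← intervalIntegrable_iff_integrableOn_Ioc_of_le hb]
    exact (intervalIntegral.intervalIntegrable_rpow' (by linarith)).const_mul q
  rw [← ofReal_integral_eq_lintegral_ofReal hint, ← integral_Ioc_eq_integral_Ioo,
    ← intervalIntegral.integral_of_le hb, intervalIntegral.integral_const_mul,
    integral_rpow (Or.inl (by linarith)), sub_add_cancel, Real.zero_rpow hq.ne', sub_zero,
    mul_div_cancel₀ _ hq.ne']
  filter_upwards [self_mem_ae_restrict measurableSet_Ioo] with t ht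
  exact mul_nonneg hq.le (Real.rpow_nonneg ht.1.le _)

/-- The value `a = ∞` is included because a maximal function may be infinite before any bound on it
is known. -/
theorem lintegral_rpow_layer {q : ℝ} (hq : 0 < q) (a : ℝ≥0∞) :
    ∫⁻ t in Ioi (0 : ℝ), (if ENNReal.ofReal t < a then ENNReal.ofReal (q * t ^ (q - 1)) else 0)
      = a ^ q := by
  have hfin : ∀ b : ℝ≥0, ∫⁻ t in Ioi (0 : ℝ),
      (if ENNReal.ofReal t < b then ENNReal.ofReal (q * t ^ (q - 1)) else 0)
        = (b : ℝ≥0∞) ^ q := by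
    intro b
    rw [← ENNReal.ofReal_coe_nnreal, ENNReal.ofReal_rpow_of_nonneg b.coe_nonneg hq.le,
      ← lintegral_rpow_layer_real hq b.coe_nonneg, ← Ioi_inter_Iio, inter_comm,
      ← Measure.restrict_restrict measurableSet_Iio, ← lintegral_indicator measurableSet_Iio]
    refine setLIntegral_congr_fun measurableSet_Ioi fun t ht => ?_
    simp only [indicator_apply, mem_Iio]
    congr 1
    exact propext (ENNReal.ofReal_lt_ofReal_iff_of_nonneg (le_of_lt ht))
  induction a with
  | coe b => exact hfin b
  | top =>
    rw [ENNReal.top_rpow_of_pos hq]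
    refine ENNReal.eq_top_of_forall_nnreal_le fun r => ?_
    -- Truncating at height `r ^ (1/q)` already produces the value `r`.
    calc (r : ℝ≥0∞) = ((r ^ (q⁻¹) : ℝ≥0) : ℝ≥0∞) ^ q := by
          rw [← ENNReal.coe_rpow_of_nonneg _ hq.le, NNReal.rpow_inv_rpow hq.ne']
      _ ≤ _ := by
          rw [← hfin]
          refine lintegral_mono fun t => ?_
          simp only [ENNReal.ofReal_lt_top, if_true]
          split_ifs <;> simp

/-- The interpolation step of Marcinkiewicz between weak type `(1, 1)` and `L^∞`. -/
theorem lintegral_rpow_le_of_weak_type {X : Type*} [MeasurableSpace X] {μ : Measure X} [SFinite μ]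
    {g h : X → ℝ≥0∞} (hg : Measurable g) (hh : Measurable h) {p : ℝ} (hp : 1 < p) {C : ℝ≥0∞}
    (H : ∀ t : ℝ, 0 < t → ENNReal.ofReal t * μ {x | ENNReal.ofReal t < h x}
      ≤ C * ∫⁻ x, (if ENNReal.ofReal t < 2 * g x then g x else 0) ∂μ) :
    ∫⁻ x, h x ^ p ∂μ
      ≤ ENNReal.ofReal (p / (p - 1)) * C * 2 ^ (p - 1) * ∫⁻ x, g x ^ p ∂μ := by
  have hp0 : 0 < p := by linarith
  have hp1 : 0 < p - 1 := by linarith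
  have hmeas : ∀ q : ℝ, ∀ u : X → ℝ≥0∞, Measurable u → Measurable (fun z : X × ℝ =>
      if ENNReal.ofReal z.2 < u z.1 then ENNReal.ofReal (q * z.2 ^ (q - 1)) else 0) := by
    intro q u hu
    refine Measurable.ite (measurableSet_lt (by fun_prop) (by fun_prop)) ?_ measurable_const
    exact ENNReal.measurable_ofReal.comp
      (((measurable_snd.pow_const (q - 1))).const_mul q)
  have hmeas' : Measurable (fun z : ℝ × X =>
      if ENNReal.ofReal z.1 < 2 * g z.2 then g z.2 else 0) :=
    Measurable.ite (measurableSet_lt (by fun_prop) (by fun_prop)) (by fun_prop) measurable_const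
  -- `w` is the layer density for the exponent `p - 1`, and `p * t ^ (p - 1) = D * w t * t`. The
  -- spare factor `t` is consumed by `H`; integrating `w` up to `2 * g x` returns `(2 * g x) ^ (p -
  -- 1)`.
  set D := ENNReal.ofReal (p / (p - 1)) with hD
  set w : ℝ → ℝ≥0∞ := fun t => ENNReal.ofReal ((p - 1) * t ^ (p - 1 - 1)) with hw
  calc ∫⁻ x, h x ^ p ∂μ
      = ∫⁻ x, (∫⁻ t in Ioi (0 : ℝ),
          (if ENNReal.ofReal t < h x then ENNReal.ofReal (p * t ^ (p - 1)) else 0)) ∂μ := by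
        simp_rw [lintegral_rpow_layer hp0]
    _ = ∫⁻ t in Ioi (0 : ℝ), ∫⁻ x,
          (if ENNReal.ofReal t < h x then ENNReal.ofReal (p * t ^ (p - 1)) else 0) ∂μ :=
        lintegral_lintegral_swap (hmeas p h hh).aemeasurable
    _ ≤ ∫⁻ t in Ioi (0 : ℝ), D * C * ∫⁻ x,
          g x * (if ENNReal.ofReal t < 2 * g x then w t else 0) ∂μ := by
        refine setLIntegral_mono' measurableSet_Ioi fun t ht => ?_
        have ht' : (0 : ℝ) < t := ht
        have hS : MeasurableSet {x | ENNReal.ofReal t < h x} := measurableSet_lt measurable_const hh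
        have e1 : ∫⁻ x, (if ENNReal.ofReal t < h x then ENNReal.ofReal (p * t ^ (p - 1)) else 0) ∂μ
            = ENNReal.ofReal (p * t ^ (p - 1)) * μ {x | ENNReal.ofReal t < h x} := by
          rw [← setLIntegral_const, ← lintegral_indicator hS]
          refine lintegral_congr fun x => ?_
          simp [indicator_apply]
        have e2 : ENNReal.ofReal (p * t ^ (p - 1)) = D * w t * ENNReal.ofReal t := by
          rw [hD, hw, ← ENNReal.ofReal_mul (by positivity), ← ENNReal.ofReal_mul (by positivity)]
          congr 1
          rw [Real.rpow_sub_one ht'.ne' (p - 1)]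
          field_simp
        have e3 : ∫⁻ x, g x * (if ENNReal.ofReal t < 2 * g x then w t else 0) ∂μ
            = w t * ∫⁻ x, (if ENNReal.ofReal t < 2 * g x then g x else 0) ∂μ := by
          rw [← lintegral_const_mul _ (by exact hmeas'.comp measurable_prodMk_left)]
          refine lintegral_congr fun x => ?_
          split_ifs <;> simp [mul_comm]
        rw [e1, e2, e3]
        calc D * w t * ENNReal.ofReal t * μ {x | ENNReal.ofReal t < h x}
            = D * w t * (ENNReal.ofReal t * μ {x | ENNReal.ofReal t < h x}) := by ring
          _ ≤ D * w t * (C * ∫⁻ x, (if ENNReal.ofReal t < 2 * g x then g x else 0) ∂μ) :=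
              mul_le_mul_right (H t ht') _
          _ = _ := by ring
    _ = D * C * ∫⁻ t in Ioi (0 : ℝ), ∫⁻ x,
          g x * (if ENNReal.ofReal t < 2 * g x then w t else 0) ∂μ := by
        refine lintegral_const_mul _ ?_
        refine Measurable.lintegral_prod_right' (f := fun z : ℝ × X =>
          g z.2 * (if ENNReal.ofReal z.1 < 2 * g z.2 then w z.1 else 0)) ?_
        exact (hg.comp measurable_snd).mul
          ((hmeas (p - 1) (fun x => 2 * g x) (by fun_prop)).comp measurable_swap)
    _ = D * C * ∫⁻ x, (∫⁻ t in Ioi (0 : ℝ),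
          g x * (if ENNReal.ofReal t < 2 * g x then w t else 0)) ∂μ := by
        congr 1
        refine (lintegral_lintegral_swap (f := fun x t =>
          g x * (if ENNReal.ofReal t < 2 * g x then w t else 0)) ?_).symm
        exact ((hg.comp measurable_fst).mul
          (hmeas (p - 1) (fun x => 2 * g x) (by fun_prop))).aemeasurable
    _ = D * C * ∫⁻ x, 2 ^ (p - 1) * g x ^ p ∂μ := by
        congr 1
        refine lintegral_congr fun x => ?_
        rw [lintegral_const_mul _ (by
          exact (hmeas (p - 1) (fun x => 2 * g x) (by fun_prop)).comp measurable_prodMk_left),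
          lintegral_rpow_layer hp1, ENNReal.mul_rpow_of_nonneg _ _ hp1.le, mul_left_comm]
        congr 1
        nth_rw 1 [← ENNReal.rpow_one (g x)]
        rw [← ENNReal.rpow_add_of_nonneg _ _ zero_le_one hp1.le, add_sub_cancel]
    _ = _ := by rw [lintegral_const_mul _ (hg.pow_const p)]; ring

/-! ### The scalar maximal function over cubes. -/

/-- The uncentered maximal function over closed balls of the sup norm, that is, over cubes. -/
def ballMaximal {n : ℕ} (g : (Fin n → ℝ) → ℝ≥0∞) (x : Fin n → ℝ) : ℝ≥0∞ :=
  ⨆ (c : Fin n → ℝ) (r : ℝ) (_ : 0 < r) (_ : x ∈ Metric.closedBall c r),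
    (volume (Metric.closedBall c r))⁻¹ * ∫⁻ y in Metric.closedBall c r, g y

theorem lt_ballMaximal_iff {n : ℕ} {g : (Fin n → ℝ) → ℝ≥0∞} {x : Fin n → ℝ} {t : ℝ≥0∞} :
    t < ballMaximal g x ↔ ∃ c r, 0 < r ∧ x ∈ Metric.closedBall c r ∧
      t < (volume (Metric.closedBall c r))⁻¹ * ∫⁻ y in Metric.closedBall c r, g y := by
  simp only [ballMaximal, lt_iSup_iff, exists_prop]

theorem ballMaximal_mono_ae {n : ℕ} {g g' : (Fin n → ℝ) → ℝ≥0∞} (h : g ≤ᵐ[volume] g')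
    (x : Fin n → ℝ) : ballMaximal g x ≤ ballMaximal g' x := by
  unfold ballMaximal
  refine iSup₂_mono fun c r => iSup₂_mono fun hr hx => mul_le_mul_right ?_ _
  exact lintegral_mono_ae (ae_restrict_of_ae h)

theorem volume_closedBall_ne_zero {n : ℕ} (c : Fin n → ℝ) {r : ℝ} (hr : 0 < r) :
    volume (Metric.closedBall c r) ≠ 0 := (Metric.measure_closedBall_pos _ _ hr).ne'

theorem volume_closedBall_ne_top {n : ℕ} (c : Fin n → ℝ) (r : ℝ) :
    volume (Metric.closedBall c r) ≠ ∞ := measure_closedBall_lt_top.ne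

theorem ballMaximal_le_essSup {n : ℕ} (g : (Fin n → ℝ) → ℝ≥0∞) (x : Fin n → ℝ) :
    ballMaximal g x ≤ essSup g volume := by
  refine iSup₂_le fun c r => iSup₂_le fun hr _ => ?_
  calc _ ≤ (volume (Metric.closedBall c r))⁻¹ *
        ∫⁻ _ in Metric.closedBall c r, essSup g volume := by
        refine mul_le_mul_right ?_ _
        exact lintegral_mono_ae (ae_restrict_of_ae (ENNReal.ae_le_essSup g))
    _ = essSup g volume := by
        rw [setLIntegral_const, mul_comm, mul_assoc,
          ENNReal.mul_inv_cancel (volume_closedBall_ne_zero c hr) (volume_closedBall_ne_top c r),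
          mul_one]

theorem ballMaximal_add_const_le {n : ℕ} {g : (Fin n → ℝ) → ℝ≥0∞} (a : ℝ≥0∞)
    (x : Fin n → ℝ) : ballMaximal (fun y => g y + a) x ≤ ballMaximal g x + a := by
  refine iSup₂_le fun c r => iSup₂_le fun hr hx => ?_
  rw [lintegral_add_right _ measurable_const, mul_add, setLIntegral_const, mul_comm _ (a * _),
    mul_assoc a, ENNReal.mul_inv_cancel (volume_closedBall_ne_zero c hr)
    (volume_closedBall_ne_top c r), mul_one]
  gcongr
  exact le_iSup₂_of_le c r (le_iSup₂_of_le hr hx le_rfl)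

/-- The weak type `(1, 1)` inequality for the maximal function over cubes. -/
theorem mul_volume_lt_ballMaximal_le {n : ℕ} (g : (Fin n → ℝ) → ℝ≥0∞) (t : ℝ≥0∞) :
    t * volume {x | t < ballMaximal g x} ≤ 5 ^ n * ∫⁻ x, g x := by
  let B : (Fin n → ℝ) × ℝ → Set (Fin n → ℝ) := fun a => Metric.closedBall a.1 a.2
  -- Vitali's lemma needs bounded radii, hence the cap `N`, removed at the end by monotone
  -- convergence.
  let T : ℕ → Set ((Fin n → ℝ) × ℝ) := fun N =>
    {a | 0 < a.2 ∧ a.2 ≤ N ∧ t * volume (B a) ≤ ∫⁻ y in B a, g y}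
  let S : ℕ → Set (Fin n → ℝ) := fun N => ⋃ a ∈ T N, B a
  have hsub : {x | t < ballMaximal g x} ⊆ ⋃ N, S N := by
    intro x hx
    obtain ⟨c, r, hr, hxc, hlt⟩ := lt_ballMaximal_iff.1 hx
    obtain ⟨N, hN⟩ := exists_nat_ge r
    refine mem_iUnion.2 ⟨N, mem_iUnion₂.2 ⟨(c, r), ⟨hr, hN, ?_⟩, hxc⟩⟩
    rw [← ENNReal.le_div_iff_mul_le (Or.inl (volume_closedBall_ne_zero c hr))
      (Or.inl (volume_closedBall_ne_top c r)), div_eq_mul_inv, mul_comm]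
    exact hlt.le
  have hmono : Monotone S := by
    intro N M hNM
    refine biUnion_subset_biUnion_left fun a ha => ⟨ha.1, ha.2.1.trans ?_, ha.2.2⟩
    exact_mod_cast hNM
  have key : ∀ N, t * volume (S N) ≤ 5 ^ n * ∫⁻ x, g x := by
    intro N
    obtain ⟨u, huT, hdisj, hcov⟩ := Vitali.exists_disjoint_subfamily_covering_enlargement_closedBall
      (T N) (fun a => a.1) (fun a => a.2) N (fun a ha => ha.2.1) 5 (by norm_num)
    -- Disjoint sets with nonempty interior in a separable space form a countable family.
    have hcount : u.Countable := hdisj.countable_of_nonempty_interior fun a ha => by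
      refine ⟨a.1, ?_⟩
      exact Metric.ball_subset_interior_closedBall (Metric.mem_ball_self (huT ha).1)
    have hScov : S N ⊆ ⋃ b ∈ u, Metric.closedBall b.1 (5 * b.2) := by
      refine iUnion₂_subset fun a ha => ?_
      obtain ⟨b, hb, hab⟩ := hcov a ha
      exact hab.trans (subset_biUnion_of_mem (u := fun b : (Fin n → ℝ) × ℝ =>
        Metric.closedBall b.1 (5 * b.2)) hb)
    have hvol : ∀ b ∈ u, volume (Metric.closedBall b.1 (5 * b.2)) = 5 ^ n * volume (B b) := by
      intro b hb
      have hb0 := (huT hb).1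
      rw [Real.volume_pi_closedBall _ hb0.le, Real.volume_pi_closedBall _ (by positivity),
        Fintype.card_fin, ← mul_assoc, mul_comm 2 5, mul_assoc, mul_pow,
        ENNReal.ofReal_mul (by positivity)]
      congr 1
      rw [ENNReal.ofReal_pow (by norm_num), ENNReal.ofReal_ofNat]
    have : Countable u := hcount.to_subtype
    calc t * volume (S N)
        ≤ t * ∑' b : u, volume (Metric.closedBall b.1.1 (5 * b.1.2)) := by
          gcongr
          exact (measure_mono hScov).trans (measure_biUnion_le volume hcount _)
      _ = ∑' b : u, 5 ^ n * (t * volume (B b)) := by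
          rw [← ENNReal.tsum_mul_left]
          refine tsum_congr fun b => ?_
          rw [hvol b b.2]
          ring
      _ ≤ ∑' b : u, 5 ^ n * ∫⁻ y in B b, g y := by
          gcongr with b
          exact (huT b.2).2.2
      _ = 5 ^ n * ∫⁻ y in ⋃ b ∈ u, B b, g y := by
          rw [ENNReal.tsum_mul_left,
            lintegral_biUnion hcount (fun b _ => Metric.isClosed_closedBall.measurableSet) hdisj]
      _ ≤ 5 ^ n * ∫⁻ x, g x := mul_le_mul_right (setLIntegral_le_lintegral _ _) _
  calc t * volume {x | t < ballMaximal g x} ≤ t * volume (⋃ N, S N) := by gcongr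
    _ = ⨆ N, t * volume (S N) := by rw [hmono.measure_iUnion, ENNReal.mul_iSup]
    _ ≤ _ := iSup_le key

/-- The part of `g` that is at most `t / 2` adds at most `t / 2` to any average, so the rest must
push the maximal function past `t / 2`. The weak type bound at that level costs the factor `2`. -/
theorem mul_volume_lt_ballMaximal_le_truncated {n : ℕ} (g : (Fin n → ℝ) → ℝ≥0∞)
    (t : ℝ≥0∞) :
    t * volume {x | t < ballMaximal g x}
      ≤ 2 * 5 ^ n * ∫⁻ x, (if t < 2 * g x then g x else 0) := by
  set f : (Fin n → ℝ) → ℝ≥0∞ := fun x => if t < 2 * g x then g x else 0 with hf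
  have hsub : {x | t < ballMaximal g x} ⊆ {x | t / 2 < ballMaximal f x} := by
    intro x hx
    have h1 : ballMaximal g x ≤ ballMaximal f x + t / 2 := by
      refine (ballMaximal_mono_ae (Filter.Eventually.of_forall fun y => ?_) x).trans
        (ballMaximal_add_const_le (g := f) (t / 2) x)
      simp only [hf]
      split_ifs with h
      · exact le_self_add
      · rw [zero_add, ENNReal.le_div_iff_mul_le (by simp) (by simp), mul_comm]
        exact not_lt.1 h
    have h2 : t / 2 + t / 2 < ballMaximal f x + t / 2 := by
      rw [ENNReal.add_halves]; exact lt_of_lt_of_le hx h1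
    exact lt_of_add_lt_add_right h2
  calc t * volume {x | t < ballMaximal g x}
      ≤ t * volume {x | t / 2 < ballMaximal f x} := by gcongr
    _ = 2 * (t / 2 * volume {x | t / 2 < ballMaximal f x}) := by
        rw [← mul_assoc, ENNReal.mul_div_cancel (by simp) (by simp)]
    _ ≤ 2 * (5 ^ n * ∫⁻ x, f x) := mul_le_mul_right (mul_volume_lt_ballMaximal_le f _) _
    _ = _ := by ring

/-- The strong type `(p, p)` inequality for functions dominated by the maximal function. -/
theorem lintegral_rpow_le_of_le_ballMaximal {n : ℕ} {g h : (Fin n → ℝ) → ℝ≥0∞}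
    (hg : AEMeasurable g volume) (hh : Measurable h) (hle : ∀ x, h x ≤ ballMaximal g x)
    {p : ℝ} (hp : 1 < p) :
    ∫⁻ x, h x ^ p
      ≤ ENNReal.ofReal (p / (p - 1)) * (2 * 5 ^ n) * 2 ^ (p - 1) * ∫⁻ x, g x ^ p := by
  -- Interpolation uses Tonelli and needs a measurable `g`; averages do not see the null set where
  -- the representative differs.
  have hgm : ∫⁻ x, g x ^ p = ∫⁻ x, hg.mk g x ^ p :=
    lintegral_congr_ae (hg.ae_eq_mk.mono fun x hx => by simp only [hx])
  rw [hgm]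
  refine lintegral_rpow_le_of_weak_type hg.measurable_mk hh hp fun t _ => ?_
  refine le_trans ?_ (mul_volume_lt_ballMaximal_le_truncated (hg.mk g) _)
  gcongr with x
  exact (hle x).trans (ballMaximal_mono_ae hg.ae_eq_mk.le x)

/-! ### Norms and closed convex hulls of symmetric sets. -/

section Sets

variable {d : ℕ}

theorem IsCS.zero_mem {K : Set (EuclideanSpace ℝ (Fin d))} (hK : IsCS K) : 0 ∈ K := by
  obtain ⟨v, hv⟩ := hK.nonempty
  have hv' : -v ∈ K := by
    rw [← hK.symmetric]
    simpa using hv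
  simpa using hK.convex.midpoint_mem hv hv'

theorem setNorm_le_iff {K : Set (EuclideanSpace ℝ (Fin d))} {c : ℝ≥0∞} :
    setNorm K ≤ c ↔ ∀ v ∈ K, ‖v‖ₑ ≤ c := iSup₂_le_iff

theorem enorm_le_setNorm {K : Set (EuclideanSpace ℝ (Fin d))} {v : EuclideanSpace ℝ (Fin d)}
    (hv : v ∈ K) : ‖v‖ₑ ≤ setNorm K := setNorm_le_iff.1 le_rfl v hv

theorem lt_setNorm_iff {K : Set (EuclideanSpace ℝ (Fin d))} {c : ℝ≥0∞} :
    c < setNorm K ↔ (K ∩ {v | c < ‖v‖ₑ}).Nonempty := by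
  simp only [setNorm, lt_iSup_iff, exists_prop]
  rfl

theorem isBCS_zero : IsBCS ({0} : Set (EuclideanSpace ℝ (Fin d))) where
  nonempty := singleton_nonempty 0
  isClosed := isClosed_singleton
  convex := convex_singleton 0
  symmetric := by simp
  isBounded := Bornology.isBounded_singleton

theorem IsCS.isBCS {K : Set (EuclideanSpace ℝ (Fin d))} (hK : IsCS K) (h : setNorm K < ∞) :
    IsBCS K where
  toIsCS := hK
  isBounded := by
    refine isBounded_iff_forall_norm_le.2 ⟨(setNorm K).toReal, fun v hv => ?_⟩
    rw [← toReal_enorm]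
    exact ENNReal.toReal_mono h.ne (enorm_le_setNorm hv)

theorem isOpen_lt_enorm (c : ℝ≥0∞) : IsOpen {v : EuclideanSpace ℝ (Fin d) | c < ‖v‖ₑ} :=
  isOpen_lt continuous_const continuous_enorm

theorem setNorm_closure_convexHull_le {S : Set (EuclideanSpace ℝ (Fin d))} {c : ℝ≥0∞}
    (h : ∀ v ∈ S, ‖v‖ₑ ≤ c) : setNorm (closure (convexHull ℝ S)) ≤ c := by
  -- Split off because `c.toReal` would be `0` here.
  rcases eq_or_ne c ∞ with rfl | hc
  · exact le_top
  have hb : ∀ v : EuclideanSpace ℝ (Fin d), v ∈ Metric.closedBall 0 c.toReal ↔ ‖v‖ₑ ≤ c := by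
    intro v
    rw [mem_closedBall_zero_iff, ← toReal_enorm, ENNReal.toReal_le_toReal enorm_ne_top hc]
  refine setNorm_le_iff.2 fun v hv => (hb v).1 ?_
  exact closure_minimal (convexHull_min (fun w hw => (hb w).2 (h w hw)) (convex_closedBall _ _))
    Metric.isClosed_closedBall hv

theorem isCS_closure_convexHull {S : Set (EuclideanSpace ℝ (Fin d))} (hne : S.Nonempty)
    (hsymm : -S = S) : IsCS (closure (convexHull ℝ S)) where
  nonempty := hne.convexHull.closure
  isClosed := isClosed_closure
  convex := (convex_convexHull ℝ S).closure
  symmetric := by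
    have h := (Homeomorph.neg (EuclideanSpace ℝ (Fin d))).preimage_closure (convexHull ℝ S)
    change -closure (convexHull ℝ S) = closure (-convexHull ℝ S) at h
    rw [h, ← convexHull_neg, hsymm]

end Sets

/-! ### Measurable set-valued maps and Aumann integrals. -/

section Measurability

variable {Ω : Type*} [MeasurableSpace Ω] {d : ℕ} {μ : Measure Ω}
  {F G : Ω → Set (EuclideanSpace ℝ (Fin d))}

/-- The norm exceeds `c` exactly when `F x` meets the open set `{v | c < ‖v‖ₑ}`. -/
theorem SetMeasurable.aemeasurable_setNorm (hF : SetMeasurable F μ) :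
    AEMeasurable (fun x => setNorm (F x)) μ := by
  refine NullMeasurable.aemeasurable ?_
  refine @measurable_of_Ioi ℝ≥0∞ (NullMeasurableSpace Ω μ) _ _ _ _ _ _ _ _ fun c => ?_
  have := hF _ (isOpen_lt_enorm c)
  simp_rw [← lt_setNorm_iff] at this
  exact this

theorem SetMeasurable.congr_ae (hF : SetMeasurable F μ) (h : F =ᵐ[μ] G) : SetMeasurable G μ := by
  intro U hU
  refine (hF U hU).congr ?_
  filter_upwards [h] with x hx
  exact congrArg (fun K => (K ∩ U).Nonempty) hx

theorem normLpK_congr_ae (h : F =ᵐ[μ] G) (p : ℝ≥0∞) : normLpK F p μ = normLpK G p μ :=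
  eLpNorm_congr_ae (h.mono fun x hx => by simp only [hx])

theorem exists_isBCS_ae_eq (hF : ∀ x, IsCS (F x)) (h : ∀ᵐ x ∂μ, setNorm (F x) < ∞) :
    ∃ G : Ω → Set (EuclideanSpace ℝ (Fin d)), (∀ x, IsBCS (G x)) ∧ F =ᵐ[μ] G := by
  classical
  refine ⟨fun x => if setNorm (F x) < ∞ then F x else {0}, fun x => ?_, ?_⟩
  · dsimp only
    split_ifs with hx
    · exact (hF x).isBCS hx
    · exact isBCS_zero
  · filter_upwards [h] with x hx
    rw [if_pos hx]

theorem zero_mem_aumannIntegral (hF : ∀ x, IsCS (F x)) : 0 ∈ aumannIntegral F μ :=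
  ⟨fun _ => 0, integrable_zero _ _ _, Filter.Eventually.of_forall fun x => (hF x).zero_mem,
    integral_zero _ _⟩

theorem neg_mem_aumannIntegral (hF : ∀ x, IsCS (F x)) {v : EuclideanSpace ℝ (Fin d)}
    (hv : v ∈ aumannIntegral F μ) : -v ∈ aumannIntegral F μ := by
  obtain ⟨f, hf, hfF, rfl⟩ := hv
  refine ⟨fun x => -f x, hf.neg, ?_, integral_neg f⟩
  filter_upwards [hfF] with x hx
  rw [← (hF x).symmetric]
  simpa using hx

/-- A selection on `s` extends by zero, as `0 ∈ F x`, without changing its integral. -/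
theorem aumannIntegral_restrict_mono (hF : ∀ x, IsCS (F x)) {s t : Set Ω} (hs : MeasurableSet s)
    (hst : s ⊆ t) :
    aumannIntegral F (μ.restrict s) ⊆ aumannIntegral F (μ.restrict t) := by
  rintro v ⟨f, hf, hfF, rfl⟩
  refine ⟨s.indicator f, (IntegrableOn.integrable_indicator hf hs).restrict, ?_, ?_⟩
  · refine ae_restrict_of_ae ?_
    filter_upwards [(ae_restrict_iff' hs).1 hfF] with x hx
    by_cases hxs : x ∈ s
    · rw [indicator_of_mem hxs]; exact hx hxs
    · rw [indicator_of_notMem hxs]; exact (hF x).zero_mem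
  · rw [setIntegral_indicator hs, inter_eq_self_of_subset_right hst]

theorem enorm_le_of_mem_aumannIntegral {v : EuclideanSpace ℝ (Fin d)}
    (hv : v ∈ aumannIntegral F μ) : ‖v‖ₑ ≤ ∫⁻ x, setNorm (F x) ∂μ := by
  obtain ⟨f, -, hfF, rfl⟩ := hv
  exact (enorm_integral_le_lintegral_enorm f).trans
    (lintegral_mono_ae (hfF.mono fun x hx => enorm_le_setNorm hx))

end Measurability

/-! ### The convex-set valued maximal operator. -/

section Maximal

variable {n d : ℕ} {F : (Fin n → ℝ) → Set (EuclideanSpace ℝ (Fin d))}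

theorem closedBall_eq_Icc_pi (c : Fin n → ℝ) {r : ℝ} (hr : 0 ≤ r) :
    Metric.closedBall c r = Icc (fun i => c i - r) (fun i => c i + r) := by
  rw [closedBall_pi c hr, ← pi_univ_Icc]
  simp_rw [Real.closedBall_eq_Icc]

theorem isCube_iff {Q : Set (Fin n → ℝ)} :
    IsCube Q ↔ ∃ (c : Fin n → ℝ) (r : ℝ), 0 < r ∧ Q = Metric.closedBall c r := by
  constructor
  · rintro ⟨a, l, hl, rfl⟩
    refine ⟨fun i => a i + l / 2, l / 2, half_pos hl, ?_⟩
    rw [closedBall_eq_Icc_pi _ (half_pos hl).le]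
    congr 1 <;> ext i <;> ring
  · rintro ⟨c, r, hr, rfl⟩
    refine ⟨fun i => c i - r, 2 * r, by positivity, ?_⟩
    rw [closedBall_eq_Icc_pi _ hr.le]
    congr 1
    ext i
    ring

theorem zero_mem_averageOp (hF : ∀ x, IsCS (F x)) (Q : Set (Fin n → ℝ)) (x : Fin n → ℝ) :
    0 ∈ averageOp Q F x := by
  unfold averageOp
  split_ifs
  · exact ⟨0, zero_mem_aumannIntegral hF, smul_zero _⟩
  · rfl

theorem neg_mem_averageOp (hF : ∀ x, IsCS (F x)) {Q : Set (Fin n → ℝ)} {x : Fin n → ℝ}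
    {v : EuclideanSpace ℝ (Fin d)} (hv : v ∈ averageOp Q F x) : -v ∈ averageOp Q F x := by
  unfold averageOp at hv ⊢
  split_ifs at hv ⊢
  · obtain ⟨w, hw, rfl⟩ := hv
    exact ⟨-w, neg_mem_aumannIntegral hF hw, smul_neg _ _⟩
  · simpa using hv

theorem enorm_le_ballMaximal_of_mem_averageOp {Q : Set (Fin n → ℝ)} (hQ : IsCube Q)
    {x : Fin n → ℝ} {v : EuclideanSpace ℝ (Fin d)} (hv : v ∈ averageOp Q F x) :
    ‖v‖ₑ ≤ ballMaximal (fun y => setNorm (F y)) x := by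
  obtain ⟨c, r, hr, rfl⟩ := isCube_iff.1 hQ
  unfold averageOp at hv
  split_ifs at hv with hx
  · obtain ⟨w, hw, rfl⟩ := hv
    refine le_trans ?_ (le_iSup₂_of_le c r (le_iSup₂_of_le hr hx le_rfl))
    dsimp only
    have hv0 := volume_closedBall_ne_zero c hr
    have hvt := volume_closedBall_ne_top c r
    rw [enorm_smul, enorm_inv (ENNReal.toReal_ne_zero.2 ⟨hv0, hvt⟩),
      Real.enorm_of_nonneg ENNReal.toReal_nonneg, ENNReal.ofReal_toReal hvt]
    exact mul_le_mul_right (enorm_le_of_mem_aumannIntegral hw) _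
  · rw [mem_singleton_iff.1 hv]
    simp

/-- The union of all averages over cubes, whose closed convex hull is the maximal operator. -/
def averageUnion (F : (Fin n → ℝ) → Set (EuclideanSpace ℝ (Fin d))) (x : Fin n → ℝ) :
    Set (EuclideanSpace ℝ (Fin d)) :=
  ⋃ (Q : Set (Fin n → ℝ)) (_ : IsCube Q), averageOp Q F x

theorem mem_averageUnion {x : Fin n → ℝ} {v : EuclideanSpace ℝ (Fin d)} :
    v ∈ averageUnion F x ↔ ∃ Q, IsCube Q ∧ v ∈ averageOp Q F x := by
  simp [averageUnion]

theorem zero_mem_averageUnion (hF : ∀ x, IsCS (F x)) (x : Fin n → ℝ) : 0 ∈ averageUnion F x :=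
  mem_averageUnion.2 ⟨_, isCube_iff.2 ⟨x, 1, one_pos, rfl⟩, zero_mem_averageOp hF _ x⟩

theorem isCS_maximalOp (hF : ∀ x, IsCS (F x)) (x : Fin n → ℝ) : IsCS (maximalOp F x) := by
  refine isCS_closure_convexHull ⟨0, zero_mem_averageUnion hF x⟩ ?_
  have hneg : ∀ v, v ∈ averageUnion F x → -v ∈ averageUnion F x := by
    intro v hv
    obtain ⟨Q, hQ, hv⟩ := mem_averageUnion.1 hv
    exact mem_averageUnion.2 ⟨Q, hQ, neg_mem_averageOp hF hv⟩
  refine Subset.antisymm (fun v hv => ?_) fun v hv => hneg v hv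
  rw [← neg_neg v]
  exact hneg _ hv

theorem setNorm_maximalOp_le (F : (Fin n → ℝ) → Set (EuclideanSpace ℝ (Fin d)))
    (x : Fin n → ℝ) : setNorm (maximalOp F x) ≤ ballMaximal (fun y => setNorm (F y)) x := by
  refine setNorm_closure_convexHull_le fun v hv => ?_
  obtain ⟨Q, hQ, hv⟩ := mem_averageUnion.1 hv
  exact enorm_le_ballMaximal_of_mem_averageOp hQ hv

/-- Enlarging a cube shows that the averages are, up to a factor close to one, locally
increasing in the base point. -/
theorem eventually_smul_mem_averageUnion (hF : ∀ x, IsCS (F x)) {x : Fin n → ℝ}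
    {v : EuclideanSpace ℝ (Fin d)} (hv : v ∈ averageUnion F x) {s : ℝ} (hs : 1 < s) :
    ∀ᶠ y in nhds x, (s ^ n)⁻¹ • v ∈ averageUnion F y := by
  obtain ⟨Q, hQ, hv⟩ := mem_averageUnion.1 hv
  obtain ⟨c, r, hr, rfl⟩ := isCube_iff.1 hQ
  unfold averageOp at hv
  split_ifs at hv with hx
  · obtain ⟨w, hw, rfl⟩ := hv
    have hrs : r < s * r := by nlinarith
    have hmem : Metric.closedBall c (s * r) ∈ nhds x :=
      Filter.mem_of_superset (Metric.isOpen_ball.mem_nhds (lt_of_le_of_lt hx hrs))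
        Metric.ball_subset_closedBall
    filter_upwards [hmem] with y hy
    refine mem_averageUnion.2 ⟨_, isCube_iff.2 ⟨c, s * r, by positivity, rfl⟩, ?_⟩
    unfold averageOp
    rw [if_pos hy]
    -- The same unnormalized integral `w` serves the dilated cube, whose volume is `s ^ n` times
    -- larger.
    refine ⟨w, aumannIntegral_restrict_mono hF Metric.isClosed_closedBall.measurableSet
      (Metric.closedBall_subset_closedBall hrs.le) hw, ?_⟩
    have hs0 : 0 ≤ s := by linarith
    dsimp only
    rw [smul_smul, Real.volume_pi_closedBall _ hr.le, Real.volume_pi_closedBall _ (by positivity),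
      ENNReal.toReal_ofReal (by positivity), ENNReal.toReal_ofReal (by positivity),
      Fintype.card_fin, ← mul_inv, ← mul_pow, mul_left_comm]
  · rw [mem_singleton_iff.1 hv, smul_zero]
    exact Filter.Eventually.of_forall fun y => zero_mem_averageUnion hF y

/-- The vectors with this property form a convex set, since two neighbourhoods of `x` intersect in a
neighbourhood; it contains the union, hence its hull. -/
theorem eventually_smul_mem_convexHull_averageUnion (hF : ∀ x, IsCS (F x)) {x : Fin n → ℝ}
    {v : EuclideanSpace ℝ (Fin d)} (hv : v ∈ convexHull ℝ (averageUnion F x)) {s : ℝ}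
    (hs : 1 < s) :
    ∀ᶠ y in nhds x, (s ^ n)⁻¹ • v ∈ convexHull ℝ (averageUnion F y) := by
  refine convexHull_min (t := {v | ∀ᶠ y in nhds x, (s ^ n)⁻¹ • v ∈ convexHull ℝ
    (averageUnion F y)}) (fun w hw => ?_) ?_ hv
  · exact (eventually_smul_mem_averageUnion hF hw hs).mono fun y hy => subset_convexHull ℝ _ hy
  · intro v hv w hw a b ha hb hab
    filter_upwards [hv, hw] with y h1 h2
    rw [smul_add, smul_comm _ a, smul_comm _ b]
    exact convex_convexHull ℝ _ h1 h2 ha hb hab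

/-- An open `U` meeting the closure meets the hull itself, at some `v`; for `s > 1` near `1` the
vector `(s ^ n)⁻¹ • v` is still in `U` and lies in the hull at all nearby points. -/
theorem isOpen_maximalOp_inter_nonempty (hF : ∀ x, IsCS (F x))
    {U : Set (EuclideanSpace ℝ (Fin d))} (hU : IsOpen U) :
    IsOpen {x | (maximalOp F x ∩ U).Nonempty} := by
  rw [isOpen_iff_mem_nhds]
  rintro x ⟨w, hw, hwU⟩
  obtain ⟨v, hvU, hv⟩ := mem_closure_iff.1 hw U hU hwU
  have hcont : Filter.Tendsto (fun s : ℝ => (s ^ n)⁻¹ • v) (nhdsWithin 1 (Ioi 1)) (nhds v) := by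
    have : ContinuousAt (fun s : ℝ => (s ^ n)⁻¹ • v) 1 := by
      have hpow : ContinuousAt (fun s : ℝ => s ^ n) 1 := (continuous_pow n).continuousAt
      exact (hpow.inv₀ (by simp)).smul continuousAt_const
    have h2 := this.tendsto
    simp only [one_pow, inv_one, one_smul] at h2
    exact h2.mono_left nhdsWithin_le_nhds
  obtain ⟨s, hsU, hs⟩ :=
    ((hcont.eventually (hU.mem_nhds hvU)).and self_mem_nhdsWithin).exists
  filter_upwards [eventually_smul_mem_convexHull_averageUnion hF hv hs] with y hy
  exact ⟨_, subset_closure hy, hsU⟩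

theorem setMeasurable_maximalOp (hF : ∀ x, IsCS (F x)) : SetMeasurable (maximalOp F) volume :=
  fun _ hU => (isOpen_maximalOp_inter_nonempty hF hU).measurableSet.nullMeasurableSet

theorem measurable_setNorm_maximalOp (hF : ∀ x, IsCS (F x)) :
    Measurable fun x => setNorm (maximalOp F x) := by
  refine measurable_of_Ioi fun c => ?_
  have := isOpen_maximalOp_inter_nonempty hF (isOpen_lt_enorm c)
  simp_rw [← lt_setNorm_iff] at this
  exact this.measurableSet

theorem normLpK_top_maximalOp_le (F : (Fin n → ℝ) → Set (EuclideanSpace ℝ (Fin d))) :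
    normLpK (maximalOp F) ∞ volume ≤ normLpK F ∞ volume := by
  simp only [normLpK, eLpNorm_exponent_top, eLpNormEssSup_eq_essSup_enorm, enorm_eq_self]
  exact essSup_le_of_ae_le _ (Filter.Eventually.of_forall fun x =>
    (setNorm_maximalOp_le F x).trans (ballMaximal_le_essSup _ x))

theorem normLpK_maximalOp_le (hF : ∀ x, IsCS (F x)) (hFm : SetMeasurable F volume)
    {p : ℝ≥0∞} (hp : 1 < p) (hp' : p ≠ ∞) :
    normLpK (maximalOp F) p volume
      ≤ (ENNReal.ofReal (p.toReal / (p.toReal - 1)) * (2 * 5 ^ n) * 2 ^ (p.toReal - 1))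
          ^ (1 / p.toReal) * normLpK F p volume := by
  have hp0 : p ≠ 0 := (zero_lt_one.trans hp).ne'
  have hp1 : 1 < p.toReal := by
    simpa using (ENNReal.toReal_lt_toReal ENNReal.one_ne_top hp').2 hp
  have hpos : 0 ≤ 1 / p.toReal := by positivity
  simp only [normLpK, eLpNorm_eq_lintegral_rpow_enorm_toReal hp0 hp', enorm_eq_self]
  rw [← ENNReal.mul_rpow_of_nonneg _ _ hpos]
  exact ENNReal.rpow_le_rpow (lintegral_rpow_le_of_le_ballMaximal hFm.aemeasurable_setNorm
    (measurable_setNorm_maximalOp hF) (setNorm_maximalOp_le F) hp1) hpos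

theorem exists_normLpK_maximalOp_le (n : ℕ) {p : ℝ≥0∞} (hp : 1 < p) :
    ∃ C : ℝ≥0, ∀ (d : ℕ) (F : (Fin n → ℝ) → Set (EuclideanSpace ℝ (Fin d))),
      (∀ x, IsCS (F x)) → SetMeasurable F volume →
        normLpK (maximalOp F) p volume ≤ C * normLpK F p volume := by
  rcases eq_or_ne p ∞ with rfl | hp'
  · exact ⟨1, fun d F _ _ => by simpa using normLpK_top_maximalOp_le F⟩
  · set K : ℝ≥0∞ := (ENNReal.ofReal (p.toReal / (p.toReal - 1)) * (2 * 5 ^ n) *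
      2 ^ (p.toReal - 1)) ^ (1 / p.toReal) with hK
    have hp1 : 1 < p.toReal := by
      simpa using (ENNReal.toReal_lt_toReal ENNReal.one_ne_top hp').2 hp
    have hKtop : K ≠ ∞ := by
      refine ENNReal.rpow_ne_top_of_nonneg (by positivity) (ENNReal.mul_ne_top (ENNReal.mul_ne_top
        ENNReal.ofReal_ne_top (ENNReal.mul_ne_top (by simp) (by simp))) ?_)
      exact ENNReal.rpow_ne_top_of_nonneg (by linarith) (by simp)
    refine ⟨K.toNNReal, fun d F hF hFm => ?_⟩
    rw [ENNReal.coe_toNNReal hKtop]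
    exact normLpK_maximalOp_le hF hFm hp hp'

theorem setNorm_lt_top_of_normLpK_top {Ω : Type*} [MeasurableSpace Ω] {μ : Measure Ω}
    {F : Ω → Set (EuclideanSpace ℝ (Fin d))} {p : ℝ≥0∞} (hp : p ≠ 0)
    (hm : AEMeasurable (fun x => setNorm (F x)) μ) (h : normLpK F p μ < ∞) :
    ∀ᵐ x ∂μ, setNorm (F x) < ∞ := by
  rcases eq_or_ne p ∞ with rfl | hp'
  · simp only [normLpK, eLpNorm_exponent_top, eLpNormEssSup_eq_essSup_enorm, enorm_eq_self] at h
    filter_upwards [ENNReal.ae_le_essSup fun x => setNorm (F x)] with x hx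
    exact hx.trans_lt h
  · have h2 := lintegral_rpow_enorm_lt_top_of_eLpNorm_lt_top hp hp' h
    simp only [enorm_eq_self] at h2
    filter_upwards [ae_lt_top' (hm.pow_const _) h2.ne] with x hx
    exact (ENNReal.rpow_lt_top_iff_of_pos (ENNReal.toReal_pos hp hp')).1 hx

theorem MemLpK.exists_memLpK_ae_eq_maximalOp {p : ℝ≥0∞} (hp : 1 < p)
    (hF : MemLpK F p volume) :
    ∃ G : (Fin n → ℝ) → Set (EuclideanSpace ℝ (Fin d)),
      MemLpK G p volume ∧ maximalOp F =ᵐ[volume] G := by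
  have hCS : ∀ x, IsCS (F x) := fun x => (hF.isBCS x).toIsCS
  obtain ⟨C, hC⟩ := exists_normLpK_maximalOp_le n hp
  have hlt : normLpK (maximalOp F) p volume < ∞ :=
    (hC d F hCS hF.measurable).trans_lt (ENNReal.mul_lt_top ENNReal.coe_lt_top hF.normLpK_lt_top)
  obtain ⟨G, hG, hae⟩ := exists_isBCS_ae_eq (isCS_maximalOp hCS)
    (setNorm_lt_top_of_normLpK_top (zero_lt_one.trans hp).ne'
      (measurable_setNorm_maximalOp hCS).aemeasurable hlt)
  exact ⟨G, ⟨hG, (setMeasurable_maximalOp hCS).congr_ae hae, normLpK_congr_ae hae p ▸ hlt⟩, hae⟩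

/-- No exceptional null set arises: averages are bounded by the essential supremum at every point.
-/
theorem MemLpK.maximalOp_top (hF : MemLpK F ∞ volume) : MemLpK (maximalOp F) ∞ volume where
  isBCS x := by
    refine (isCS_maximalOp (fun x => (hF.isBCS x).toIsCS) x).isBCS ?_
    refine ((setNorm_maximalOp_le F x).trans (ballMaximal_le_essSup _ x)).trans_lt ?_
    have := hF.normLpK_lt_top
    simpa only [normLpK, eLpNorm_exponent_top, eLpNormEssSup_eq_essSup_enorm, enorm_eq_self]
      using this
  measurable := setMeasurable_maximalOp fun x => (hF.isBCS x).toIsCS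
  normLpK_lt_top := (normLpK_top_maximalOp_le F).trans_lt hF.normLpK_lt_top

theorem mul_volume_lt_setNorm_maximalOp_le (F : (Fin n → ℝ) → Set (EuclideanSpace ℝ (Fin d)))
    (t : ℝ≥0∞) :
    t * volume {x | t < setNorm (maximalOp F x)} ≤ 5 ^ n * ∫⁻ x, setNorm (F x) :=
  (mul_le_mul_right (measure_mono fun x hx => lt_of_lt_of_le hx (setNorm_maximalOp_le F x)) t).trans
    (mul_volume_lt_ballMaximal_le _ t)

/-- The set where the norm is infinite lies in every superlevel set, so `t` times its measure is
bounded uniformly in `t`. -/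
theorem setNorm_maximalOp_lt_top_ae (h : ∫⁻ x, setNorm (F x) ≠ ∞) :
    ∀ᵐ x, setNorm (maximalOp F x) < ∞ := by
  set A := 5 ^ n * ∫⁻ x, setNorm (F x) with hA
  have hAtop : A ≠ ∞ := ENNReal.mul_ne_top (by simp) h
  by_contra hcon
  have hne : volume {x | ¬ setNorm (maximalOp F x) < ∞} ≠ 0 := fun h0 => hcon h0
  have hle : ∀ t : ℝ≥0, (t : ℝ≥0∞) * volume {x | ¬ setNorm (maximalOp F x) < ∞} ≤ A := by
    intro t
    refine le_trans ?_ (mul_volume_lt_setNorm_maximalOp_le F t)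
    refine mul_le_mul_right (measure_mono fun x hx => ?_) _
    exact lt_of_lt_of_le ENNReal.coe_lt_top (not_lt.1 hx)
  obtain ⟨t, ht⟩ := ENNReal.exists_nat_mul_gt hne hAtop
  exact absurd (hle t) (not_le.2 (by simpa using ht))

theorem MemLpK.exists_memWeakL1K_ae_eq_maximalOp (hF : MemLpK F 1 volume) :
    ∃ G : (Fin n → ℝ) → Set (EuclideanSpace ℝ (Fin d)),
      MemWeakL1K G volume ∧ maximalOp F =ᵐ[volume] G := by
  have hCS : ∀ x, IsCS (F x) := fun x => (hF.isBCS x).toIsCS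
  have hint : ∫⁻ x, setNorm (F x) ≠ ∞ := by
    have := hF.normLpK_lt_top
    simp only [normLpK, eLpNorm_one_eq_lintegral_enorm, enorm_eq_self] at this
    exact this.ne
  obtain ⟨G, hG, hae⟩ := exists_isBCS_ae_eq (isCS_maximalOp hCS) (setNorm_maximalOp_lt_top_ae hint)
  refine ⟨G, ⟨hG, (setMeasurable_maximalOp hCS).congr_ae hae, ?_⟩, hae⟩
  refine lt_of_le_of_lt (b := 5 ^ n * ∫⁻ x, setNorm (F x)) (iSup₂_le fun t _ => ?_)
    (ENNReal.mul_lt_top (by simp) hint.lt_top)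
  refine le_trans (le_of_eq ?_) (mul_volume_lt_setNorm_maximalOp_le F (ENNReal.ofReal t))
  congr 1
  refine measure_congr ?_
  filter_upwards [hae] with x hx
  exact congrArg (fun K => ENNReal.ofReal t < setNorm K) hx.symm

end Maximal

end ConvexSetValued

end

theorem mainTheorem5 (n : ℕ) :
    (∀ p : ℝ≥0∞, 1 < p → ∃ C : ℝ≥0, ∀ (d : ℕ)
      (F : (Fin n → ℝ) → Set (EuclideanSpace ℝ (Fin d))),
      ConvexSetValued.MemLpK F p volume →
        (∀ x, ConvexSetValued.IsCS (ConvexSetValued.maximalOp F x)) ∧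
        ConvexSetValued.SetMeasurable (ConvexSetValued.maximalOp F) volume ∧
        (∃ G : (Fin n → ℝ) → Set (EuclideanSpace ℝ (Fin d)),
          ConvexSetValued.MemLpK G p volume ∧ ConvexSetValued.maximalOp F =ᵐ[volume] G) ∧
        (p = ∞ → ConvexSetValued.MemLpK (ConvexSetValued.maximalOp F) p volume) ∧
        ConvexSetValued.normLpK (ConvexSetValued.maximalOp F) p volume
          ≤ C * ConvexSetValued.normLpK F p volume) ∧
    (∃ C : ℝ≥0, ∀ (d : ℕ) (F : (Fin n → ℝ) → Set (EuclideanSpace ℝ (Fin d))),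
      ConvexSetValued.MemLpK F 1 volume →
        (∀ x, ConvexSetValued.IsCS (ConvexSetValued.maximalOp F x)) ∧
        ConvexSetValued.SetMeasurable (ConvexSetValued.maximalOp F) volume ∧
        (∃ G : (Fin n → ℝ) → Set (EuclideanSpace ℝ (Fin d)),
          ConvexSetValued.MemWeakL1K G volume ∧ ConvexSetValued.maximalOp F =ᵐ[volume] G) ∧
        ∀ t : ℝ, 0 < t →
          volume {x | ENNReal.ofReal t < ConvexSetValued.setNorm (ConvexSetValued.maximalOp F x)}
            ≤ ENNReal.ofReal (C / t) * ∫⁻ x, ConvexSetValued.setNorm (F x)) := by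
  -- The weak type constant `5 ^ n` is the volume cost of Vitali's fivefold enlargement.
  refine ⟨fun p hp => ?_, 5 ^ n, fun d F hF => ?_⟩
  · obtain ⟨C, hC⟩ := ConvexSetValued.exists_normLpK_maximalOp_le n hp
    refine ⟨C, fun d F hF => ?_⟩
    have hCS : ∀ x, ConvexSetValued.IsCS (F x) := fun x => (hF.isBCS x).toIsCS
    refine ⟨ConvexSetValued.isCS_maximalOp hCS, ConvexSetValued.setMeasurable_maximalOp hCS,
      hF.exists_memLpK_ae_eq_maximalOp hp, ?_, hC d F hCS hF.measurable⟩
    rintro rfl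
    exact hF.maximalOp_top
  · have hCS : ∀ x, ConvexSetValued.IsCS (F x) := fun x => (hF.isBCS x).toIsCS
    refine ⟨ConvexSetValued.isCS_maximalOp hCS, ConvexSetValued.setMeasurable_maximalOp hCS,
      hF.exists_memWeakL1K_ae_eq_maximalOp, fun t ht => ?_⟩
    have h := ConvexSetValued.mul_volume_lt_setNorm_maximalOp_le F (ENNReal.ofReal t)
    have hC : ENNReal.ofReal (((5 ^ n : ℝ≥0) : ℝ) / t) = 5 ^ n / ENNReal.ofReal t := by
      rw [ENNReal.ofReal_div_of_pos ht, ENNReal.ofReal_coe_nnreal]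
      simp
    rw [hC, div_eq_mul_inv, mul_right_comm, ← div_eq_mul_inv,
      ENNReal.le_div_iff_mul_le (Or.inl (by simpa using ht)) (Or.inl ENNReal.ofReal_ne_top),
      mul_comm]
    exact h
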